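/- Conventions. $H(\omega_1)$ is the family of sets whose transitive closure is countable, and $\prec^*$ is a fixed well-ordering of $H(\omega_1)$. A sequence $\langle *_\alpha : \alpha<\omega_1\rangle$ of elements of $H(\omega_1)$ is continuous if $*_\alpha=\{*_\beta : \beta<\alpha\}$ for every limit $\alpha<\omega_1$. For $f,g\in\omega^\omega$, $f<^*g$ means that $f(k)<g(k)$ for all but finitely many $k$. "Limit ordinal" means nonzero limit ordinal. $\diamondsuit^*_{\mathrm{EL}}(\mathfrak d)$ is the following principle: for every sequence $\langle h_\alpha : \alpha<\omega_1\rangle$ of elements of $H(\omega_1)$ there is a sequence $\langle d_\alpha : \alpha<\omega_1\rangle$ in $\omega^\omega$ such that for every continuous sequence $\langle *_\alpha : \alpha<\omega_1\rangle$ of elements of $H(\omega_1)$ there is a $\subseteq$-increasing chain $\langle M_\alpha : \alpha<\omega_1\rangle$ of elementary submodels of $(H(\omega_1);\in,\prec^*)$ with (a) $*_\alpha,\ h_\alpha,\ \{M_\beta : \beta<\alpha\}\in M_{\alpha+1}$ for all $\alpha<\omega_1$, and (b) the set $\{\alpha<\omega_1 : f<^*d_\alpha \text{ for all } f\in\omega^\omega\cap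 M_{\alpha+1}\}$ contains a closed unbounded subset of $\omega_1$. $\clubsuit_{\mathrm{AD}}(\omega_1,\omega,\mathrm{DIAG})$ asserts that there is a family $\langle B^n_\alpha : \alpha<\omega_1,\ n<\omega\rangle$ of sets of ordinals such that: (1) for every limit $\alpha<\omega_1$ and every $n<\omega$, $B^n_\alpha$ is a cofinal subset of $\alpha$; (2) for all $0<\alpha<\beta<\omega_1$ and $m,n<\omega$, $\sup(B^m_\alpha\cap B^n_\beta)<\alpha$; (3) for every sequence $\langle X_\gamma : \gamma<\omega_1\rangle$ of cofinal subsets of $\omega_1$, the set of all $\alpha<\omega_1$ such that $X_\gamma\cap B^n_\alpha$ is a cofinal subset of $\alpha$ for all $\gamma<\alpha$ and all $n<\omega$ is stationary in $\omega_1$. Theorem. $\diamondsuit^*_{\mathrm{EL}}(\mathfrak d)$ implies $\clubsuit_{\mathrm{AD}}(\omega_1,\omega,\mathrm{DIAG})$. Moreover, the witnessing family can be chosen so that, for every limit $\alpha<\omega_1$, every $B^n_\alpha$ ($n<\omega$) has order type $\omega$, and the sets $B^n_\alpha$ ($n<\omega$) are pairwise disjoint. -/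

import Mathlib

open scoped Ordinal Cardinal

noncomputable section

namespace ElDiamond

/-- `H(κ)`: the sets whose transitive closure has size `< κ`, that is, the sets contained in some
transitive set of size `< κ`. -/
def H (κ : Cardinal.{0}) : Set ZFSet.{0} :=
  {x | ∃ t : ZFSet.{0}, t.IsTransitive ∧ x ⊆ t ∧ t.card < κ}

/-- The relation symbols of the language `{∈, ≺*}`. -/
inductive Rel : ℕ → Type
  | mem : Rel 2
  | prec : Rel 2

/-- The first-order language `{∈, ≺*}` with two binary relation symbols. -/
def lang : FirstOrder.Language.{0, 0} := ⟨fun _ => Empty, Rel⟩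

/-- The structure `(N; ∈, ≺*)`. -/
@[reducible]
def struct (N : Set ZFSet.{0}) (prec : N → N → Prop) : lang.Structure N where
  funMap := fun f => f.elim
  RelMap := fun R => match R with
    | Rel.mem => fun v => (v 0 : ZFSet.{0}) ∈ (v 1 : ZFSet.{0})
    | Rel.prec => fun v => prec (v 0) (v 1)

/-- The set `m` is (the universe of) an elementary submodel of `(N; ∈, ≺*)`. -/
def IsElementarySubmodel (N : Set ZFSet.{0}) (prec : N → N → Prop) (m : ZFSet.{0}) : Prop :=
  letI := struct N prec
  ∃ S : lang.ElementarySubstructure N,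
    ∀ z : ZFSet.{0}, z ∈ m ↔ ∃ h : z ∈ N, (⟨z, h⟩ : N) ∈ S

/-- The set `{x_β | β < α}`. -/
def initialSet (x : Ordinal.{0} → ZFSet.{0}) (α : Ordinal.{0}) : ZFSet.{0} :=
  ZFSet.range (fun β : Set.Iio α => x β)

/-- The sequence `(x_α)_{α < ω₁}` is continuous: `x_α = {x_β | β < α}` for every limit `α < ω₁`. -/
def IsContinuousSeq (x : Ordinal.{0} → ZFSet.{0}) : Prop :=
  ∀ α < ω₁, Order.IsSuccLimit α → x α = initialSet x α

/-- The club-guessing elementary diamond `◇*_EL((A, B, E), N)` over the structure `(N; ∈, ≺*)`. All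
sequences are indexed by `α < ω₁`; their values at other ordinals play no role. -/
def ElDiamondStar (N : Set ZFSet.{0}) (prec : N → N → Prop) (A B : Set ZFSet.{0})
    (E : ZFSet.{0} → ZFSet.{0} → Prop) : Prop :=
  ∀ h : Ordinal.{0} → ZFSet.{0}, (∀ α < ω₁, h α ∈ N) →
    ∃ b : Ordinal.{0} → ZFSet.{0}, (∀ α < ω₁, b α ∈ B) ∧
      ∀ s : Ordinal.{0} → ZFSet.{0}, (∀ α < ω₁, s α ∈ H ℵ₁) → IsContinuousSeq s →
        ∃ M : Ordinal.{0} → ZFSet.{0},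
          (∀ α < ω₁, IsElementarySubmodel N prec (M α)) ∧
          (∀ α β, α ≤ β → β < ω₁ → M α ⊆ M β) ∧
          (∀ α < ω₁, s α ∈ M (α + 1) ∧ h α ∈ M (α + 1) ∧ initialSet M α ∈ M (α + 1)) ∧
          ∃ C : Set (Set.Iio (ω₁ : Ordinal.{0})), IsClub C ∧
            ∀ α ∈ C, ∀ a ∈ A, a ∈ M ((α : Ordinal.{0}) + 1) → E a (b α)

/-- The set-theoretic function `{(n, f(n)) | n < ω}` given by `f : ℕ → ℕ`. -/
def real (f : ℕ → ℕ) : ZFSet.{0} :=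
  ZFSet.range (fun n : ℕ =>
    ZFSet.pair (Ordinal.toZFSet (n : Ordinal.{0})) (Ordinal.toZFSet (f n : Ordinal.{0})))

/-- Eventual domination `f <* g`. -/
def EventuallyDominates (f g : ℕ → ℕ) : Prop := ∃ n, ∀ k > n, f k < g k

/-- The Baire space `ω^ω`, as a set of sets. -/
def Baire : Set ZFSet.{0} := Set.range real

/-- Eventual domination, as a relation on the elements of `Baire`. -/
def Dom (x y : ZFSet.{0}) : Prop :=
  ∃ f g : ℕ → ℕ, x = real f ∧ y = real g ∧ EventuallyDominates f g

/-- `◇*_EL(𝔡)`, where `𝔡 = (ω^ω, ω^ω, <*)` and the structure is `(H(ω₁); ∈, ≺*)`. -/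
def ElDiamondStarD (prec : H ℵ₁ → H ℵ₁ → Prop) : Prop :=
  ElDiamondStar (H ℵ₁) prec Baire Baire Dom

/-- `S` is a cofinal subset of the ordinal `α`. -/
def IsCofinalSubset (S : Set Ordinal.{0}) (α : Ordinal.{0}) : Prop :=
  S ⊆ Set.Iio α ∧ ∀ β < α, ∃ ξ ∈ S, β ≤ ξ

/-- The family `(B^n_α)_{α < ω₁, n < ω}` witnesses `♣_AD(ω₁, ω, DIAG)`. -/
structure IsClubADDiag (B : Ordinal.{0} → ℕ → Set Ordinal.{0}) : Prop where
  cofinal : ∀ α < ω₁, Order.IsSuccLimit α → ∀ n, IsCofinalSubset (B α n) α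
  /-- `sup (B^m_α ∩ B^n_β) < α`; the case `α = 0` is void, since `sup ∅ < 0` is impossible. -/
  almostDisjoint : ∀ α β, 0 < α → α < β → β < ω₁ → ∀ m n,
    ∃ δ < α, ∀ ξ ∈ B α m ∩ B β n, ξ ≤ δ
  guess : ∀ X : Ordinal.{0} → Set Ordinal.{0}, (∀ γ < ω₁, IsCofinalSubset (X γ) ω₁) →
    IsStationary {α : Set.Iio (ω₁ : Ordinal.{0}) |
      ∀ γ < (α : Ordinal.{0}), ∀ n, IsCofinalSubset (X γ ∩ B α n) α}

end ElDiamond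

end

namespace ElDiamond

open FirstOrder FirstOrder.Language

/-! For each limit `α < ω₁` fix an enumeration `e` of `α` and a ladder `L` in `α`. If `f` picks
indices with `e (f k) ∈ X γ` and `L k ≤ e (f k)`, and `f <* g`, then for almost all `i` the point `e
(f (growth g i))` falls into the `i`-th block built from `g`. The blocks are finite and lie in
consecutive intervals, so a union of infinitely many of them has order type `ω` and meets `X γ`
cofinally (`column_inter_cofinal`). Thus one `g` dominating a suitable `f` for each `γ < α` serves
all `γ` and all columns at once.

The principle provides such a `g`, namely `d α`, as soon as the functions `f` can be found in `M (α
+ 1)`. To this end `X` is coded into a continuous sequence `guessSeq X`, whose entry at `α` is a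
parameter available in `M (α + 1)`; elementarity then yields `f`
(`IsElementarySubmodel.exists_isLinkedSelector`, `IsLinkedSelector.exists_eq_real`). Almost
disjointness is automatic, since each column above `α` has only finitely many points below `α`. -/

/-! ### Closure properties of `H(ω₁)`. -/

theorem H_trans {κ : Cardinal.{0}} {x y : ZFSet.{0}} (hy : y ∈ H κ) (hx : x ∈ y) : x ∈ H κ := by
  obtain ⟨t, ht, hyt, hc⟩ := hy
  exact ⟨t, ht, ht.subset_of_mem (hyt hx), hc⟩

theorem range_mem_H {ι : Type*} [Small.{0} ι] [Countable ι] {f : ι → ZFSet.{0}}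
    (hf : ∀ i, f i ∈ H ℵ₁) : ZFSet.range f ∈ H ℵ₁ := by
  choose t ht hft hc using hf
  have key : ∀ x : ZFSet.{0}, x.card < ℵ₁ ↔ Countable x := by
    intro x
    rw [Cardinal.lt_aleph_one_iff, ← Cardinal.mk_le_aleph0_iff, ZFSet.cardinalMk_coe_sort,
      Cardinal.lift_le_aleph0]
  refine ⟨ZFSet.range f ∪ ZFSet.iUnion t, ?_, ?_, ?_⟩
  · intro y hy z hz
    rw [ZFSet.mem_union] at hy ⊢
    right
    rw [ZFSet.mem_iUnion]
    rcases hy with hy | hy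
    · obtain ⟨i, rfl⟩ := ZFSet.mem_range.1 hy
      exact ⟨i, hft i hz⟩
    · obtain ⟨i, hi⟩ := ZFSet.mem_iUnion.1 hy
      exact ⟨i, (ht i).subset_of_mem hi hz⟩
  · intro z hz
    exact ZFSet.mem_union.2 (Or.inl hz)
  · rw [key]
    have h1 : ((ZFSet.range f ∪ ZFSet.iUnion t : ZFSet) : Set ZFSet) =
        Set.range f ∪ ⋃ i, (t i : Set ZFSet) := by
      ext z; simp
    have h2 : ((ZFSet.range f ∪ ZFSet.iUnion t : ZFSet) : Set ZFSet).Countable := by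
      rw [h1]
      refine (Set.countable_range f).union (Set.countable_iUnion fun i => ?_)
      exact Set.countable_coe_iff.1 ((key _).1 (hc i))
    exact Set.countable_coe_iff.2 h2

theorem doubleton_mem_H {x y : ZFSet.{0}} (hx : x ∈ H ℵ₁) (hy : y ∈ H ℵ₁) :
    ({x, y} : ZFSet) ∈ H ℵ₁ := by
  have : ({x, y} : ZFSet) = ZFSet.range (fun b : Bool => if b then x else y) := by
    ext z; simp [eq_comm, or_comm]
  rw [this]
  exact range_mem_H fun b => by cases b <;> simpa

theorem pair_mem_H {x y : ZFSet.{0}} (hx : x ∈ H ℵ₁) (hy : y ∈ H ℵ₁) :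
    ZFSet.pair x y ∈ H ℵ₁ := by
  unfold ZFSet.pair
  refine doubleton_mem_H ?_ (doubleton_mem_H hx hy)
  rw [← ZFSet.pair_eq_singleton]
  exact doubleton_mem_H hx hx

theorem card_lt_aleph_one {α : Ordinal.{0}} (h : α < ω₁) : α.card < ℵ₁ := by
  rwa [← Cardinal.lt_ord, Cardinal.ord_aleph]

theorem toZFSet_mem_H {α : Ordinal.{0}} (h : α < ω₁) : α.toZFSet ∈ H ℵ₁ :=
  ⟨α.toZFSet, (ZFSet.isOrdinal_toZFSet α).isTransitive, fun _ h => h, by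
    rw [Ordinal.card_toZFSet]; exact card_lt_aleph_one h⟩

theorem countable_Iio {α : Ordinal.{0}} (h : α < ω₁) : Countable (Set.Iio α) := by
  rw [← Cardinal.mk_le_aleph0_iff, Cardinal.mk_Iio_ordinal, Cardinal.lift_le_aleph0,
    ← Cardinal.lt_aleph_one_iff]
  exact card_lt_aleph_one h

/-! ### Elementarity for a single formula. -/

/-- `f` is a choice of one element from each member of the partition `p`, and each of its elements
is linked by a member of `h` to a member of `s` that contains `c`. -/
def IsLinkedSelector (f p h s c : ZFSet.{0}) : Prop :=
  (∀ z ∈ f, ∃ k ∈ p, z ∈ k) ∧ (∀ k ∈ p, ∃ z, z ∈ k ∧ z ∈ f ∧ ∀ w, w ∈ k → w ∈ f → w = z) ∧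
    ∀ z ∈ f, ∃ y ∈ h, ∃ t ∈ s, ∃ u, z ∈ y ∧ u ∈ y ∧ u ∈ t ∧ c ∈ t

/-- The symbol `∈` of the language. -/
def memRel : lang.Relations 2 := Rel.mem

/-- The atomic formula `a ∈ b`. -/
def memFormula {n : ℕ} (a b : lang.Term (Fin 4 ⊕ Fin n)) : lang.BoundedFormula (Fin 4) n :=
  Relations.boundedFormula₂ memRel a b

/-- The parameter `i`. -/
def param (n : ℕ) (i : Fin 4) : lang.Term (Fin 4 ⊕ Fin n) := Term.var (Sum.inl i)

/-- The first-order formula expressing `IsLinkedSelector`. -/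
def linkedSelectorFormula : lang.BoundedFormula (Fin 4) 1 :=
  (∀' ((memFormula &1 &0).imp (∃' (memFormula &2 (param 3 0) ⊓ memFormula &1 &2)))) ⊓
  ((∀' ((memFormula &1 (param 2 0)).imp (∃' (memFormula &2 &1 ⊓ (memFormula &2 &0 ⊓
      ∀' ((memFormula &3 &1).imp ((memFormula &3 &0).imp (Term.bdEqual &3 &2)))))))) ⊓
  (∀' ((memFormula &1 &0).imp (∃' (memFormula &2 (param 3 1) ⊓ ∃' (memFormula &3 (param 4 2) ⊓
      ∃' (memFormula &1 &2 ⊓ (memFormula &4 &2 ⊓ (memFormula &4 &3 ⊓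
        memFormula (param 5 3) &3)))))))))

theorem realize_memFormula (N : Set ZFSet.{0}) (prec : N → N → Prop) {n : ℕ}
    (a b : lang.Term (Fin 4 ⊕ Fin n)) (v : Fin 4 → N) (xs : Fin n → N) :
    letI := struct N prec
    (memFormula a b).Realize v xs ↔
      ((a.realize (Sum.elim v xs) : N) : ZFSet) ∈ ((b.realize (Sum.elim v xs) : N) : ZFSet) := by
  let := struct N prec
  unfold memFormula
  rw [BoundedFormula.realize_rel₂]
  rfl

/-- Every quantifier is bounded by a set in `H κ`, so transitivity of `H κ` makes the formula
absolute. Stating the property through `∈` and `=` alone avoids formalizing ordered pairs, functions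
and ordinals in the language. -/
theorem realize_linkedSelectorFormula {κ : Cardinal.{0}} (prec : H κ → H κ → Prop)
    (v : Fin 4 → H κ) (xs : Fin 1 → H κ) :
    letI := struct (H κ) prec
    linkedSelectorFormula.Realize v xs ↔
      IsLinkedSelector (xs 0) (v 0) (v 1) (v 2) (v 3) := by
  let := struct (H κ) prec
  have key := fun n a b v xs => realize_memFormula (H κ) prec (n := n) a b v xs
  unfold linkedSelectorFormula
  simp only [BoundedFormula.realize_inf, BoundedFormula.realize_all, BoundedFormula.realize_imp,
    BoundedFormula.realize_ex, BoundedFormula.realize_bdEqual, key, Term.realize_var,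
    Sum.elim_inr, Sum.elim_inl, param, Function.comp]
  change (_ ∧ _ ∧ _) ↔ _
  unfold IsLinkedSelector
  refine and_congr ?_ (and_congr ?_ ?_)
  · change (∀ z : H κ, (z : ZFSet) ∈ (xs 0 : ZFSet) →
      ∃ k : H κ, (k : ZFSet) ∈ (v 0 : ZFSet) ∧ (z : ZFSet) ∈ (k : ZFSet)) ↔ _
    constructor
    · intro h z hz
      obtain ⟨k, hk⟩ := h ⟨z, H_trans (xs 0).2 hz⟩ hz
      exact ⟨k, hk⟩
    · intro h z hz
      obtain ⟨k, hk⟩ := h z hz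
      exact ⟨⟨k, H_trans (v 0).2 hk.1⟩, hk⟩
  · change (∀ k : H κ, (k : ZFSet) ∈ (v 0 : ZFSet) → ∃ z : H κ, (z : ZFSet) ∈ (k : ZFSet) ∧
      (z : ZFSet) ∈ (xs 0 : ZFSet) ∧ ∀ w : H κ, (w : ZFSet) ∈ (k : ZFSet) →
        (w : ZFSet) ∈ (xs 0 : ZFSet) → w = z) ↔ _
    constructor
    · intro h k hk
      obtain ⟨z, hz, hz', hw⟩ := h ⟨k, H_trans (v 0).2 hk⟩ hk
      exact ⟨z, hz, hz', fun w h1 h2 => congrArg Subtype.val (hw ⟨w, H_trans (xs 0).2 h2⟩ h1 h2)⟩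
    · intro h k hk
      obtain ⟨z, hz, hz', hw⟩ := h k hk
      exact ⟨⟨z, H_trans (xs 0).2 hz'⟩, hz, hz', fun w h1 h2 => Subtype.ext (hw w h1 h2)⟩
  · change (∀ z : H κ, (z : ZFSet) ∈ (xs 0 : ZFSet) → ∃ y : H κ, (y : ZFSet) ∈ (v 1 : ZFSet) ∧
      ∃ t : H κ, (t : ZFSet) ∈ (v 2 : ZFSet) ∧ ∃ u : H κ, (z : ZFSet) ∈ (y : ZFSet) ∧
        (u : ZFSet) ∈ (y : ZFSet) ∧ (u : ZFSet) ∈ (t : ZFSet) ∧ (v 3 : ZFSet) ∈ (t : ZFSet)) ↔ _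
    constructor
    · intro h z hz
      obtain ⟨y, hy, t, ht, u, hu⟩ := h ⟨z, H_trans (xs 0).2 hz⟩ hz
      exact ⟨y, hy, t, ht, u, hu⟩
    · intro h z hz
      obtain ⟨y, hy, t, ht, u, hu⟩ := h z hz
      exact ⟨⟨y, H_trans (v 1).2 hy⟩, hy, ⟨t, H_trans (v 2).2 ht⟩, ht,
        ⟨u, H_trans (H_trans (v 1).2 hy) hu.2.1⟩, hu⟩

theorem IsElementarySubmodel.exists_isLinkedSelector {κ : Cardinal.{0}} {prec : H κ → H κ → Prop}
    {m p h s c : ZFSet.{0}} (hm : IsElementarySubmodel (H κ) prec m) (hp : p ∈ m) (hh : h ∈ m)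
    (hs : s ∈ m) (hc : c ∈ m) (hf : ∃ f ∈ H κ, IsLinkedSelector f p h s c) :
    ∃ f ∈ m, IsLinkedSelector f p h s c := by
  let := struct (H κ) prec
  obtain ⟨S, hS⟩ := hm
  obtain ⟨p', hp⟩ := (hS p).1 hp
  obtain ⟨h', hh⟩ := (hS h).1 hh
  obtain ⟨s', hs⟩ := (hS s).1 hs
  obtain ⟨c', hc⟩ := (hS c).1 hc
  obtain ⟨f, hfH, hf⟩ := hf
  let v : Fin 4 → S := ![⟨_, hp⟩, ⟨_, hh⟩, ⟨_, hs⟩, ⟨_, hc⟩]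
  have h1 : (linkedSelectorFormula.ex).Realize (S.subtype ∘ v) (S.subtype ∘ Fin.elim0) := by
    rw [BoundedFormula.realize_ex]
    exact ⟨⟨f, hfH⟩, (realize_linkedSelectorFormula prec _ _).2 hf⟩
  rw [S.subtype.map_boundedFormula, BoundedFormula.realize_ex] at h1
  obtain ⟨g, hg⟩ := h1
  rw [← S.subtype.map_boundedFormula] at hg
  exact ⟨((g : H κ) : ZFSet), (hS _).2 ⟨(g : H κ).2, g.2⟩,
    (realize_linkedSelectorFormula prec _ _).1 hg⟩

end ElDiamond

namespace ElDiamond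

/-! ### Ladders, blocks and columns. -/

/-- `e` enumerates the ordinals below `α`, and `L` is a cofinal ladder in `α` that outgrows `e`. -/
structure IsEnumLadder (α : Ordinal.{0}) (e L : ℕ → Ordinal.{0}) : Prop where
  lt : ∀ k, e k < α
  surj : ∀ ξ < α, ∃ k, e k = ξ
  strictMono : StrictMono L
  ladder_lt : ∀ k, L k < α
  lt_ladder : ∀ k, e k < L (k + 1)

theorem exists_isEnumLadder {α : Ordinal.{0}} (h : α < ω₁) (hl : Order.IsSuccLimit α) :
    ∃ e L, IsEnumLadder α e L := by
  have := countable_Iio h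
  have h0 : 0 < α := hl.bot_lt
  have : Nonempty (Set.Iio α) := ⟨⟨0, h0⟩⟩
  obtain ⟨e, he⟩ := exists_surjective_nat (Set.Iio α)
  let L : ℕ → Ordinal.{0} := fun k => Nat.rec 0 (fun i x => Order.succ (max x (e i))) k
  have hL : ∀ k, L (k + 1) = Order.succ (max (L k) (e k)) := fun k => rfl
  refine ⟨fun k => e k, L, fun k => (e k).2, fun ξ hξ => ?_, ?_, ?_, ?_⟩
  · obtain ⟨k, hk⟩ := he ⟨ξ, hξ⟩
    exact ⟨k, by rw [hk]⟩
  · refine strictMono_nat_of_lt_succ fun k => ?_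
    rw [hL]
    exact (le_max_left _ _).trans_lt (Order.lt_succ _)
  · intro k
    induction k with
    | zero => exact h0
    | succ k ih =>
      rw [hL]
      exact hl.succ_lt (max_lt ih (e k).2)
  · intro k
    rw [hL]
    exact (le_max_right _ _).trans_lt (Order.lt_succ _)

/-- The strictly increasing sequence of natural numbers obtained by iterating `g`. -/
def growth (g : ℕ → ℕ) : ℕ → ℕ
  | 0 => 0
  | i + 1 => max (growth g i + 1) (g (growth g i))

theorem growth_strictMono (g : ℕ → ℕ) : StrictMono (growth g) :=
  strictMono_nat_of_lt_succ fun _ => (Nat.lt_succ_self _).trans_le (le_max_left _ _)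

theorem le_growth_succ (g : ℕ → ℕ) (i : ℕ) : g (growth g i) ≤ growth g (i + 1) :=
  le_max_right _ _

/-- The `i`-th finite block: the first ladder point of the `i`-th interval, together with the
points of this interval that are enumerated before stage `growth g (i + 1)`. -/
def block (e L : ℕ → Ordinal.{0}) (g : ℕ → ℕ) (i : ℕ) : Set Ordinal.{0} :=
  insert (L (growth g i))
    ({ξ | L (growth g i) ≤ ξ ∧ ξ < L (growth g (i + 1))} ∩ e '' Set.Iio (growth g (i + 1)))

/-- The union of infinitely many blocks; different columns use different blocks. -/
def column (e L : ℕ → Ordinal.{0}) (g : ℕ → ℕ) (n : ℕ) : Set Ordinal.{0} :=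
  ⋃ i ∈ {i : ℕ | (Nat.unpair i).1 = n}, block e L g i

section column

variable {α : Ordinal.{0}} {e L : ℕ → Ordinal.{0}}

theorem block_finite (e L : ℕ → Ordinal.{0}) (g : ℕ → ℕ) (i : ℕ) : (block e L g i).Finite :=
  (((Set.finite_Iio _).image e).inter_of_right _).insert _

theorem block_subset (h : IsEnumLadder α e L) (g : ℕ → ℕ) (i : ℕ) :
    block e L g i ⊆ Set.Ico (L (growth g i)) (L (growth g (i + 1))) := by
  rintro ξ (rfl | hξ)
  · exact ⟨le_rfl, h.strictMono (growth_strictMono g (Nat.lt_succ_self i))⟩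
  · exact hξ.1

theorem eq_of_mem_block (h : IsEnumLadder α e L) {g : ℕ → ℕ} {i j : ℕ} {ξ : Ordinal.{0}}
    (hi : ξ ∈ block e L g i) (hj : ξ ∈ block e L g j) : i = j := by
  have key : ∀ {i j : ℕ}, ξ ∈ block e L g i → ξ ∈ block e L g j → ¬ i < j := fun {i j} hi hj hij =>
    ((block_subset h g i hi).2.trans_le
      ((h.strictMono.monotone ((growth_strictMono g).monotone (Nat.succ_le_of_lt hij))).trans
        (block_subset h g j hj).1)).false
  exact le_antisymm (not_lt.1 (key hj hi)) (not_lt.1 (key hi hj))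

theorem column_subset (h : IsEnumLadder α e L) (g : ℕ → ℕ) (n : ℕ) :
    column e L g n ⊆ Set.Iio α :=
  Set.iUnion₂_subset fun i _ _ hξ => (block_subset h g i hξ).2.trans (h.ladder_lt _)

theorem column_disjoint (h : IsEnumLadder α e L) (g : ℕ → ℕ) {m n : ℕ} (hmn : m ≠ n) :
    Disjoint (column e L g m) (column e L g n) := by
  rw [Set.disjoint_left]
  intro ξ hm hn
  obtain ⟨i, hi, hξ⟩ := Set.mem_iUnion₂.1 hm
  obtain ⟨j, hj, hξ'⟩ := Set.mem_iUnion₂.1 hn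
  obtain rfl := eq_of_mem_block h hξ hξ'
  exact hmn (hi.symm.trans hj)

theorem exists_column_index (h : IsEnumLadder α e L) (g : ℕ → ℕ) (n k : ℕ) {β : Ordinal.{0}}
    (hβ : β < α) : ∃ i, (Nat.unpair i).1 = n ∧ k < growth g i ∧ β ≤ L (growth g i) := by
  obtain ⟨j, rfl⟩ := h.surj β hβ
  -- Column `n` uses arbitrarily late blocks because `Nat.pair n N ≥ N`, and `growth g i ≥ i`.
  have h1 : max (j + 1) (k + 1) ≤ growth g (Nat.pair n (max (j + 1) (k + 1))) :=
    (Nat.right_le_pair _ _).trans (growth_strictMono g).le_apply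
  refine ⟨Nat.pair n (max (j + 1) (k + 1)), by simp, by omega, ?_⟩
  exact (h.lt_ladder j).le.trans (h.strictMono.monotone (by omega))

theorem column_cofinal (h : IsEnumLadder α e L) (g : ℕ → ℕ) (n : ℕ) :
    IsCofinalSubset (column e L g n) α := by
  refine ⟨column_subset h g n, fun β hβ => ?_⟩
  obtain ⟨i, hi, -, hL⟩ := exists_column_index h g n 0 hβ
  exact ⟨L (growth g i), Set.mem_biUnion (x := i) hi (Set.mem_insert _ _), hL⟩

/-- Once a block starts at or above `β`, it and all later blocks miss `Iio β`; finitely many finite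
blocks remain. -/
theorem column_inter_Iio_finite (h : IsEnumLadder α e L) (g : ℕ → ℕ) (n : ℕ) {β : Ordinal.{0}}
    (hβ : β < α) : (column e L g n ∩ Set.Iio β).Finite := by
  obtain ⟨i, -, -, hL⟩ := exists_column_index h g n 0 hβ
  refine ((Set.finite_Iio i).biUnion fun j _ => block_finite e L g j).subset ?_
  rintro ξ ⟨hξ, hξβ⟩
  obtain ⟨j, -, hj⟩ := Set.mem_iUnion₂.1 hξ
  refine Set.mem_biUnion (x := j) ((growth_strictMono g).lt_iff_lt.1 (h.strictMono.lt_iff_lt.1 ?_)) hj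
  exact (block_subset h g j hj).1.trans_lt (lt_of_lt_of_le hξβ hL)

/-- Where domination holds, `f (growth g i) < growth g (i + 1)`. This puts the chosen point among
those enumerated in time for block `i`, and, as `e j < L (j + 1)`, also below the right end of its
interval. -/
theorem column_inter_cofinal (h : IsEnumLadder α e L) {g f : ℕ → ℕ} {X : Set Ordinal.{0}}
    (hfg : EventuallyDominates f g) (hX : ∀ k, e (f k) ∈ X) (hL : ∀ k, L k ≤ e (f k)) (n : ℕ) :
    IsCofinalSubset (X ∩ column e L g n) α := by
  refine ⟨Set.inter_subset_right.trans (column_subset h g n), fun β hβ => ?_⟩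
  obtain ⟨m, hm⟩ := hfg
  obtain ⟨i, hi, hmi, hβL⟩ := exists_column_index h g n m hβ
  have hlt : f (growth g i) < growth g (i + 1) := (hm _ hmi).trans_le (le_growth_succ g i)
  refine ⟨e (f (growth g i)), ⟨hX _, Set.mem_biUnion (x := i) hi (Or.inr ⟨⟨hL _, ?_⟩, ?_⟩)⟩,
    hβL.trans (hL _)⟩
  · exact (h.lt_ladder _).trans_le (h.strictMono.monotone hlt)
  · exact Set.mem_image_of_mem e hlt

end column

/-! ### Order type and reflection to a limit point of a club. -/

theorem type_eq_omega0 {S : Set Ordinal.{0}} {α : Ordinal.{0}} (hα : Order.IsSuccLimit α)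
    (hS : IsCofinalSubset S α) (hfin : ∀ β < α, (S ∩ Set.Iio β).Finite) :
    Ordinal.type (fun x y : S => x < y) = ω := by
  apply le_antisymm
  · refine le_of_forall_lt fun o ho => ?_
    obtain ⟨x, rfl⟩ := Ordinal.typein_surj _ ho
    rw [← Ordinal.card_lt_aleph0, Ordinal.card_typein, Cardinal.lt_aleph0_iff_finite]
    have := (hfin x (hS.1 x.2)).to_subtype
    exact Finite.of_injective
      (fun y : {y : S // y < x} => (⟨y.1, y.1.2, y.2⟩ : ↥(S ∩ Set.Iio x.1)))
      fun y z hyz => Subtype.ext (Subtype.ext (congrArg (fun w => w.1) hyz))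
  · rw [← Ordinal.aleph0_le_card, Ordinal.card_type, Cardinal.aleph0_le_mk_iff,
      Set.infinite_coe_iff]
    intro hfinite
    obtain ⟨ξ, hξ, -⟩ := hS.2 0 hα.bot_lt
    obtain ⟨x, hx, hmax⟩ := hfinite.exists_maximal ⟨ξ, hξ⟩
    obtain ⟨y, hy, hxy⟩ := hS.2 _ (hα.succ_lt (hS.1 hx))
    have hlt := Order.succ_le_iff.1 hxy
    exact (hmax hy hlt.le).not_gt hlt

/-- Closing off in `ω` steps: between consecutive points of `D` every `X γ` with `γ` at most the
earlier point gets an element. Only countably many `γ` are treated at each step, so the next point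
stays below `ω₁`. -/
theorem exists_limit_mem_club {X : Ordinal.{0} → Set Ordinal.{0}}
    (hX : ∀ γ < ω₁, IsCofinalSubset (X γ) ω₁) {D : Set (Set.Iio (ω₁ : Ordinal.{0}))}
    (hD : IsClub D) : ∃ α ∈ D, Order.IsSuccLimit (α : Ordinal.{0}) ∧
      ∀ γ < (α : Ordinal.{0}), IsCofinalSubset (X γ ∩ Set.Iio α) α := by
  have hl : Order.IsSuccLimit (ω₁ : Ordinal.{0}) := Cardinal.isSuccLimit_omega 1
  have step : ∀ β : Set.Iio (ω₁ : Ordinal.{0}), ∃ β' : Set.Iio (ω₁ : Ordinal.{0}),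
      β' ∈ D ∧ β < β' ∧ ∀ γ ≤ (β : Ordinal.{0}), ∃ ξ ∈ X γ, (β : Ordinal.{0}) ≤ ξ ∧ ξ < β' := by
    intro β
    have hs := hl.succ_lt β.2
    have := countable_Iio hs
    have h1 : ∀ γ : Set.Iio (Order.succ (β : Ordinal.{0})), ∃ ξ ∈ X γ, (β : Ordinal.{0}) ≤ ξ :=
      fun γ => (hX γ (γ.2.trans hs)).2 β β.2
    choose ξ hξ hβξ using h1
    have hsup : (⨆ γ, ξ γ) < ω₁ :=
      Ordinal.iSup_lt_omega_one fun γ => (hX γ (γ.2.trans hs)).1 (hξ γ)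
    obtain ⟨β', hβ', hle⟩ := hD.isCofinal ⟨_, hl.succ_lt (max_lt β.2 hsup)⟩
    have hlt : max (β : Ordinal.{0}) (⨆ γ, ξ γ) < β' := Order.succ_le_iff.1 hle
    refine ⟨β', hβ', Subtype.coe_lt_coe.1 ((le_max_left _ _).trans_lt hlt), fun γ hγ => ?_⟩
    exact ⟨_, hξ ⟨γ, Order.lt_succ_of_le hγ⟩, hβξ _,
      ((Ordinal.le_iSup _ _).trans (le_max_right _ _)).trans_lt hlt⟩
  choose G hGD hG hGX using step
  let a : ℕ → Set.Iio (ω₁ : Ordinal.{0}) := fun k => G^[k] (G ⟨0, hl.bot_lt⟩)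
  have ha : ∀ k, a (k + 1) = G (a k) := fun k => Function.iterate_succ_apply' G k _
  have hmono : StrictMono a := strictMono_nat_of_lt_succ fun k => by rw [ha]; exact hG _
  have haD : ∀ k, a k ∈ D := by
    rintro (_ | k)
    · exact hGD _
    · rw [ha]; exact hGD _
  have hsup : (⨆ k, (a k : Ordinal.{0})) < ω₁ := Ordinal.iSup_lt_omega_one fun k => (a k).2
  have hlub : IsLUB (Set.range a) ⟨_, hsup⟩ := by
    constructor
    · rintro _ ⟨k, rfl⟩
      exact Ordinal.le_iSup (fun k => (a k : Ordinal.{0})) k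
    · intro b hb
      exact Ordinal.iSup_le fun k => hb ⟨k, rfl⟩
  have hex : ∀ β < ⨆ k, (a k : Ordinal.{0}), ∃ k, β < a k := fun β hβ => Ordinal.lt_iSup_iff.1 hβ
  have hlt : ∀ k, (a k : Ordinal.{0}) < ⨆ k, (a k : Ordinal.{0}) := fun k =>
    (show (a k : Ordinal.{0}) < a (k + 1) from hmono (Nat.lt_succ_self k)).trans_le
      (Ordinal.le_iSup (fun k => (a k : Ordinal.{0})) _)
  refine ⟨⟨_, hsup⟩, hD.isLUB_mem (Set.range_subset_iff.2 haD) (Set.range_nonempty a) hlub,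
    ?_, fun γ hγ => ⟨Set.inter_subset_right, fun β hβ => ?_⟩⟩
  · refine Order.isSuccLimit_iff_of_orderBot.2 ⟨(bot_le.trans_lt (hlt 0)).ne',
      Order.isSuccPrelimit_of_succ_lt fun β hβ => ?_⟩
    obtain ⟨k, hk⟩ := hex β hβ
    exact (Order.succ_le_of_lt hk).trans_lt (hlt k)
  · obtain ⟨k, hk⟩ := hex (max γ β) (max_lt hγ hβ)
    obtain ⟨ξ, hξ, h1, h2⟩ := hGX (a k) γ ((le_max_left _ _).trans hk.le)
    rw [← ha] at h2
    exact ⟨ξ, ⟨hξ, h2.trans (hlt _)⟩, ((le_max_right _ _).trans hk.le).trans h1⟩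

end ElDiamond

noncomputable section

namespace ElDiamond

/-! ### Coding functions, ladders and the sets `X γ`. -/

/-- The ordered pair of two natural numbers, as a set. -/
def natPair (n j : ℕ) : ZFSet.{0} :=
  ZFSet.pair (Ordinal.toZFSet (n : Ordinal.{0})) (Ordinal.toZFSet (j : Ordinal.{0}))

theorem natPair_inj {n j n' j' : ℕ} : natPair n j = natPair n' j' ↔ n = n' ∧ j = j' := by
  unfold natPair
  rw [ZFSet.pair_inj, Ordinal.toZFSet_injective.eq_iff, Ordinal.toZFSet_injective.eq_iff,
    Nat.cast_inj, Nat.cast_inj]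

theorem mem_real {f : ℕ → ℕ} {z : ZFSet.{0}} : z ∈ real f ↔ ∃ n, natPair n (f n) = z :=
  ZFSet.mem_range

theorem real_injective : Function.Injective real := fun f g h => by
  funext n
  obtain ⟨k, hk⟩ := mem_real.1 (h ▸ mem_real.2 ⟨n, rfl⟩ : natPair n (f n) ∈ real g)
  obtain ⟨rfl, h2⟩ := natPair_inj.1 hk
  exact h2.symm

/-- The partition of `ω × ω` into the columns `{n} × ω`. -/
def natColumns : ZFSet.{0} := ZFSet.range fun n : ℕ => ZFSet.range fun j : ℕ => natPair n j

/-- A set coding the ordinal `β`, distinct from all ordinals and from all pairs of natural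
numbers. -/
def marker (β : Ordinal.{0}) : ZFSet.{0} := ZFSet.pair β.toZFSet (Ordinal.toZFSet ω)

/-- The relation `L k ≤ e j`, each instance of which is linked to the marker of `e j`. -/
def linkSet (e L : ℕ → Ordinal.{0}) : ZFSet.{0} :=
  ZFSet.range fun q : {q : ℕ × ℕ // L q.1 ≤ e q.2} => {natPair q.1.1 q.1.2, marker (e q.1.2)}

theorem toZFSet_nat_mem_H (n : ℕ) : Ordinal.toZFSet (n : Ordinal.{0}) ∈ H ℵ₁ :=
  toZFSet_mem_H ((Ordinal.natCast_lt_omega0 n).trans Ordinal.omega0_lt_omega_one)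

theorem natPair_mem_H (n j : ℕ) : natPair n j ∈ H ℵ₁ :=
  pair_mem_H (toZFSet_nat_mem_H n) (toZFSet_nat_mem_H j)

theorem real_mem_H (f : ℕ → ℕ) : real f ∈ H ℵ₁ := range_mem_H fun _ => natPair_mem_H _ _

theorem natColumns_mem_H : natColumns ∈ H ℵ₁ :=
  range_mem_H fun _ => range_mem_H fun _ => natPair_mem_H _ _

theorem marker_mem_H {β : Ordinal.{0}} (h : β < ω₁) : marker β ∈ H ℵ₁ :=
  pair_mem_H (toZFSet_mem_H h) (toZFSet_mem_H Ordinal.omega0_lt_omega_one)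

theorem linkSet_mem_H {e : ℕ → Ordinal.{0}} (he : ∀ k, e k < ω₁) (L : ℕ → Ordinal.{0}) :
    linkSet e L ∈ H ℵ₁ :=
  range_mem_H fun _ => doubleton_mem_H (natPair_mem_H _ _) (marker_mem_H (he _))

theorem empty_notMem_pair (x y : ZFSet.{0}) : ∅ ∉ ZFSet.pair x y := by
  intro h
  have hx : ∀ z : ZFSet.{0}, x ∈ z → ∅ ≠ z := fun z hz h0 => ZFSet.notMem_empty x (h0 ▸ hz)
  rcases ZFSet.mem_pair.1 h with h | h
  · exact hx _ (ZFSet.mem_singleton.2 rfl) h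
  · exact hx _ (ZFSet.mem_pair.2 (Or.inl rfl)) h

theorem empty_mem_toZFSet (γ : Ordinal.{0}) : ∅ ∈ (γ + 1).toZFSet := by
  rw [← Ordinal.toZFSet_zero, Ordinal.toZFSet_mem_toZFSet_iff, ← Order.succ_eq_add_one]
  exact Order.bot_lt_succ γ

theorem pair_ne_toZFSet (x y : ZFSet.{0}) (γ : Ordinal.{0}) : ZFSet.pair x y ≠ (γ + 1).toZFSet :=
  fun h => empty_notMem_pair x y (h ▸ empty_mem_toZFSet γ)

theorem natPair_ne_marker (n j : ℕ) (β : Ordinal.{0}) : natPair n j ≠ marker β := fun h =>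
  (Ordinal.natCast_lt_omega0 j).ne (Ordinal.toZFSet_injective (ZFSet.pair_inj.1 h).2)

theorem marker_ne_empty (β : Ordinal.{0}) : marker β ≠ ∅ := fun h =>
  ZFSet.notMem_empty _ (h ▸ ZFSet.mem_pair.2 (Or.inl rfl) : ({β.toZFSet} : ZFSet) ∈ (∅ : ZFSet))

theorem marker_inj {β β' : Ordinal.{0}} : marker β = marker β' ↔ β = β' := by
  unfold marker
  rw [ZFSet.pair_inj, Ordinal.toZFSet_injective.eq_iff, and_iff_left rfl]

open Classical in
/-- A continuous sequence coding `X`: its entry at `β + 1` consists of the marker of `β` and of the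
codes of all `γ ≤ β` with `β ∈ X γ`. -/
def guessSeq (X : Ordinal.{0} → Set Ordinal.{0}) (α : Ordinal.{0}) : ZFSet.{0} :=
  Ordinal.limitRecOn α {marker 0}
    (fun β _ => ZFSet.range fun γ : Set.Iio (β + 1 + 1) =>
      if γ ≤ β ∧ β ∈ X γ then Ordinal.toZFSet ((γ : Ordinal.{0}) + 1) else marker β)
    (fun α _ ih => ZFSet.range fun β : Set.Iio α => ih β β.2)

section guessSeq

variable {X : Ordinal.{0} → Set Ordinal.{0}}

theorem guessSeq_zero : guessSeq X 0 = {marker 0} := Ordinal.limitRecOn_zero ..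

open Classical in
theorem guessSeq_add_one (β : Ordinal.{0}) : guessSeq X (β + 1) =
    ZFSet.range fun γ : Set.Iio (β + 1 + 1) =>
      if γ ≤ β ∧ β ∈ X γ then Ordinal.toZFSet ((γ : Ordinal.{0}) + 1) else marker β :=
  Ordinal.limitRecOn_add_one ..

theorem guessSeq_limit {α : Ordinal.{0}} (h : Order.IsSuccLimit α) :
    guessSeq X α = initialSet (guessSeq X) α :=
  Ordinal.limitRecOn_limit (h := h) ..

theorem mem_guessSeq_add_one {β : Ordinal.{0}} {z : ZFSet.{0}} : z ∈ guessSeq X (β + 1) ↔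
    z = marker β ∨ ∃ γ ≤ β, β ∈ X γ ∧ z = Ordinal.toZFSet (γ + 1) := by
  rw [guessSeq_add_one, ZFSet.mem_range]
  constructor
  · rintro ⟨γ, rfl⟩
    split_ifs with h
    · exact Or.inr ⟨γ, h.1, h.2, rfl⟩
    · exact Or.inl rfl
  · rintro (rfl | ⟨γ, hγ, hX, rfl⟩)
    · have h : β < β + 1 := Order.lt_add_one_iff.2 le_rfl
      -- The extra index `β + 1` fails `γ ≤ β`, so the marker is always present.
      exact ⟨⟨β + 1, Set.mem_Iio.2 (Order.lt_add_one_iff.2 le_rfl)⟩, if_neg fun h' => h'.1.not_gt h⟩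
    · refine ⟨⟨γ, Order.lt_add_one_iff.2 (hγ.trans (Order.lt_add_one_iff.2 le_rfl).le)⟩, ?_⟩
      exact if_pos ⟨hγ, hX⟩

theorem guessSeq_mem_H (α : Ordinal.{0}) (hα : α < ω₁) : guessSeq X α ∈ H ℵ₁ := by
  induction α using Ordinal.limitRecOn with
  | zero =>
    rw [guessSeq_zero, ← ZFSet.pair_eq_singleton]
    exact doubleton_mem_H (marker_mem_H hα) (marker_mem_H hα)
  | add_one β ih =>
    have hl : Order.IsSuccLimit (ω₁ : Ordinal.{0}) := Cardinal.isSuccLimit_omega 1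
    have hβ : β < ω₁ := (Order.lt_add_one_iff.2 le_rfl).trans hα
    have hα' : β + 1 + 1 < ω₁ := Order.succ_eq_add_one (β + 1) ▸ hl.succ_lt hα
    rw [guessSeq_add_one]
    have := countable_Iio hα'
    refine range_mem_H fun γ => ?_
    split_ifs with h
    · exact toZFSet_mem_H ((add_le_add_left h.1 1).trans_lt hα)
    · exact marker_mem_H hβ
  | limit α hl ih =>
    rw [guessSeq_limit hl]
    have := countable_Iio hα
    exact range_mem_H fun β => ih β β.2 (lt_trans β.2 hα)

theorem isContinuousSeq_guessSeq : IsContinuousSeq (guessSeq X) := fun _ _ h => guessSeq_limit h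

theorem guessSeq_ne_empty (α : Ordinal.{0}) : guessSeq X α ≠ ∅ := by
  suffices h : ∃ z, z ∈ guessSeq X α by
    rintro h0
    obtain ⟨z, hz⟩ := h
    exact ZFSet.notMem_empty z (h0 ▸ hz)
  induction α using Ordinal.limitRecOn with
  | zero => exact ⟨_, guessSeq_zero (X := X) ▸ ZFSet.mem_singleton.2 rfl⟩
  | add_one β ih => exact ⟨_, mem_guessSeq_add_one.2 (Or.inl rfl)⟩
  | limit α hl ih =>
    rw [guessSeq_limit hl]
    exact ⟨_, ZFSet.mem_range_self (⟨0, hl.bot_lt⟩ : Set.Iio α)⟩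

/-- Every code `γ + 1` contains `∅`, so this keeps entries of the sequence, hence the members of its
limit entries, from being mistaken for codes. -/
theorem empty_notMem_guessSeq (α : Ordinal.{0}) : ∅ ∉ guessSeq X α := by
  induction α using Ordinal.limitRecOn with
  | zero =>
    rw [guessSeq_zero, ZFSet.mem_singleton]
    exact (marker_ne_empty 0).symm
  | add_one β ih =>
    intro h
    rcases mem_guessSeq_add_one.1 h with h | ⟨γ, -, -, h⟩
    · exact marker_ne_empty β h.symm
    · exact ZFSet.notMem_empty _ (h ▸ empty_mem_toZFSet γ : (∅ : ZFSet) ∈ (∅ : ZFSet))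
  | limit α hl ih =>
    rw [guessSeq_limit hl]
    intro h
    obtain ⟨β, hβ⟩ := ZFSet.mem_range.1 h
    exact guessSeq_ne_empty _ hβ

theorem eq_add_one_of_toZFSet_mem_guessSeq {γ δ : Ordinal.{0}}
    (h : Ordinal.toZFSet (γ + 1) ∈ guessSeq X δ) : ∃ β, δ = β + 1 ∧ β ∈ X γ := by
  induction δ using Ordinal.limitRecOn with
  | zero =>
    rw [guessSeq_zero, ZFSet.mem_singleton] at h
    exact absurd h.symm (pair_ne_toZFSet _ _ _)
  | add_one β ih =>
    rcases mem_guessSeq_add_one.1 h with h | ⟨γ', -, hX, h⟩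
    · exact absurd h.symm (pair_ne_toZFSet _ _ _)
    · have h2 := Ordinal.toZFSet_injective h
      rw [← Order.succ_eq_add_one, ← Order.succ_eq_add_one, Order.succ_eq_succ_iff] at h2
      exact ⟨β, rfl, h2 ▸ hX⟩
  | limit α hl ih =>
    rw [guessSeq_limit hl] at h
    obtain ⟨β, hβ⟩ := ZFSet.mem_range.1 h
    exact absurd (hβ ▸ empty_mem_toZFSet γ) (empty_notMem_guessSeq _)

end guessSeq

/-! ### Linked selectors are exactly the functions wanted. -/

section linked

variable {α γ : Ordinal.{0}} {e L : ℕ → Ordinal.{0}} {X : Ordinal.{0} → Set Ordinal.{0}}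

theorem isLinkedSelector_real {f : ℕ → ℕ} (hα : Order.IsSuccLimit α) (hlt : ∀ k, e k < α)
    (hX : ∀ k, e (f k) ∈ X γ) (hL : ∀ k, L k ≤ e (f k)) (hγ : ∀ k, γ ≤ e (f k)) :
    IsLinkedSelector (real f) natColumns (linkSet e L) (guessSeq X α)
      (Ordinal.toZFSet (γ + 1)) := by
  refine ⟨fun z hz => ?_, fun k hk => ?_, fun z hz => ?_⟩
  · obtain ⟨n, rfl⟩ := mem_real.1 hz
    exact ⟨_, ZFSet.mem_range_self n, ZFSet.mem_range_self (f n)⟩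
  · obtain ⟨n, rfl⟩ := ZFSet.mem_range.1 hk
    refine ⟨natPair n (f n), ZFSet.mem_range_self (f n), mem_real.2 ⟨n, rfl⟩, fun w hw hw' => ?_⟩
    obtain ⟨j, rfl⟩ := ZFSet.mem_range.1 hw
    obtain ⟨n', h⟩ := mem_real.1 hw'
    obtain ⟨rfl, rfl⟩ := natPair_inj.1 h
    rfl
  · obtain ⟨n, rfl⟩ := mem_real.1 hz
    refine ⟨{natPair n (f n), marker (e (f n))},
      ZFSet.mem_range.2 ⟨⟨(n, f n), hL n⟩, rfl⟩, guessSeq X (e (f n) + 1), ?_,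
      marker (e (f n)), ZFSet.mem_pair.2 (Or.inl rfl), ZFSet.mem_pair.2 (Or.inr rfl),
      mem_guessSeq_add_one.2 (Or.inl rfl),
      mem_guessSeq_add_one.2 (Or.inr ⟨γ, hγ n, hX n, rfl⟩)⟩
    rw [guessSeq_limit hα]
    have h1 : e (f n) + 1 < α := by
      rw [← Order.succ_eq_add_one]
      exact hα.succ_lt (hlt _)
    exact ZFSet.mem_range_self (⟨_, h1⟩ : Set.Iio α)

theorem IsLinkedSelector.exists_eq_real {F : ZFSet.{0}} (hα : Order.IsSuccLimit α)
    (hF : IsLinkedSelector F natColumns (linkSet e L) (guessSeq X α) (Ordinal.toZFSet (γ + 1))) :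
    ∃ f : ℕ → ℕ, F = real f ∧ (∀ k, e (f k) ∈ X γ) ∧ ∀ k, L k ≤ e (f k) := by
  obtain ⟨hF1, hF2, hF3⟩ := hF
  have h1 : ∀ n : ℕ, ∃ j : ℕ, natPair n j ∈ F ∧ ∀ i, natPair n i ∈ F → i = j := by
    intro n
    obtain ⟨z, hz, hzF, hw⟩ := hF2 _ (ZFSet.mem_range_self n)
    obtain ⟨j, rfl⟩ := ZFSet.mem_range.1 hz
    exact ⟨j, hzF, fun i hi =>
      (natPair_inj.1 (hw _ (ZFSet.mem_range_self i) hi)).2⟩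
  choose f hf hfu using h1
  have key : ∀ k, e (f k) ∈ X γ ∧ L k ≤ e (f k) := by
    intro k
    obtain ⟨y, hy, t, ht, u, hzy, huy, hut, hct⟩ := hF3 _ (hf k)
    obtain ⟨⟨⟨k', j⟩, hkj⟩, rfl⟩ := ZFSet.mem_range.1 hy
    rw [guessSeq_limit hα] at ht
    obtain ⟨⟨δ, hδ⟩, rfl⟩ := ZFSet.mem_range.1 ht
    obtain ⟨β, rfl, hβ⟩ := eq_add_one_of_toZFSet_mem_guessSeq hct
    rcases ZFSet.mem_pair.1 hzy with h | h
    · obtain ⟨rfl, h⟩ := natPair_inj.1 h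
      dsimp only at h hkj huy
      subst h
      refine ⟨?_, hkj⟩
      -- The link `u` cannot be the pair of numbers, as entries at successors hold only markers and
      -- codes; so it is the marker of `e j`, and it identifies `β`.
      rcases ZFSet.mem_pair.1 huy with rfl | rfl
      · rcases mem_guessSeq_add_one.1 hut with h | ⟨_, -, -, h⟩
        · exact absurd h (natPair_ne_marker _ _ _)
        · exact absurd h (pair_ne_toZFSet _ _ _)
      · rcases mem_guessSeq_add_one.1 hut with h | ⟨_, -, -, h⟩
        · rwa [marker_inj.1 h]
        · exact absurd h (pair_ne_toZFSet _ _ _)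
    · exact absurd h (natPair_ne_marker _ _ _)
  refine ⟨f, ?_, fun k => (key k).1, fun k => (key k).2⟩
  ext z
  rw [mem_real]
  constructor
  · intro hz
    obtain ⟨c, hc, hzc⟩ := hF1 z hz
    obtain ⟨n, rfl⟩ := ZFSet.mem_range.1 hc
    obtain ⟨j, rfl⟩ := ZFSet.mem_range.1 hzc
    exact ⟨n, by rw [hfu n j hz]⟩
  · rintro ⟨n, rfl⟩
    exact hf n

end linked

/-- The parameters of the elementary diamond: the columns of `ω × ω` at `0`, the link set of an
enumerated ladder at limit ordinals, and `α` itself at successor ordinals. -/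
def paramSeq (e L : Ordinal.{0} → ℕ → Ordinal.{0}) (α : Ordinal.{0}) : ZFSet.{0} :=
  Ordinal.limitRecOn α natColumns (fun β _ => Ordinal.toZFSet (β + 1))
    (fun α _ _ => linkSet (e α) (L α))

theorem paramSeq_zero (e L : Ordinal.{0} → ℕ → Ordinal.{0}) : paramSeq e L 0 = natColumns :=
  Ordinal.limitRecOn_zero ..

theorem paramSeq_add_one (e L : Ordinal.{0} → ℕ → Ordinal.{0}) (β : Ordinal.{0}) :
    paramSeq e L (β + 1) = Ordinal.toZFSet (β + 1) :=
  Ordinal.limitRecOn_add_one ..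

theorem paramSeq_limit (e L : Ordinal.{0} → ℕ → Ordinal.{0}) {α : Ordinal.{0}}
    (h : Order.IsSuccLimit α) : paramSeq e L α = linkSet (e α) (L α) :=
  Ordinal.limitRecOn_limit (h := h) ..

end ElDiamond

end

open ElDiamond

/-! ### The main theorem. -/

theorem mainTheorem5
    (prec : ElDiamond.H ℵ₁ → ElDiamond.H ℵ₁ → Prop)
    (hprec : IsWellOrder (ElDiamond.H ℵ₁) prec)
    (hD : ElDiamond.ElDiamondStarD prec) :
    ∃ B : Ordinal.{0} → ℕ → Set Ordinal.{0},
      ElDiamond.IsClubADDiag B ∧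
      (∀ α < ω₁, Order.IsSuccLimit α → ∀ n,
        Ordinal.type (fun x y : B α n => x < y) = ω) ∧
      (∀ α < ω₁, Order.IsSuccLimit α → ∀ m n, m ≠ n → Disjoint (B α m) (B α n)) := by
  classical
  have hl : Order.IsSuccLimit (ω₁ : Ordinal.{0}) := Cardinal.isSuccLimit_omega 1
  have hs : ∀ {β : Ordinal.{0}}, β < ω₁ → β + 1 < ω₁ := fun h => by
    rw [← Order.succ_eq_add_one]; exact hl.succ_lt h
  have hex : ∀ α : Ordinal.{0}, ∃ e L, α < ω₁ → Order.IsSuccLimit α → IsEnumLadder α e L := by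
    intro α
    by_cases h : α < ω₁ ∧ Order.IsSuccLimit α
    · obtain ⟨e, L, h⟩ := exists_isEnumLadder h.1 h.2
      exact ⟨e, L, fun _ _ => h⟩
    · exact ⟨fun _ => 0, fun _ => 0, fun h1 h2 => absurd ⟨h1, h2⟩ h⟩
  choose e L heL using hex
  obtain ⟨d, hd, hd'⟩ := hD (paramSeq e L) fun α hα => by
    induction α using Ordinal.limitRecOn with
    | zero => exact paramSeq_zero e L ▸ natColumns_mem_H
    | add_one β _ => exact paramSeq_add_one e L β ▸ toZFSet_mem_H hα
    | limit α hlim _ =>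
      rw [paramSeq_limit e L hlim]
      exact linkSet_mem_H (fun k => ((heL α hα hlim).lt k).trans hα) _
  have hg : ∀ α : Ordinal.{0}, ∃ g : ℕ → ℕ, α < ω₁ → real g = d α := by
    intro α
    by_cases h : α < ω₁
    · obtain ⟨g, hg⟩ := hd α h
      exact ⟨g, fun _ => hg⟩
    · exact ⟨id, fun h' => absurd h' h⟩
  choose g hg using hg
  let B : Ordinal.{0} → ℕ → Set Ordinal.{0} := fun α n =>
    if Order.IsSuccLimit α then column (e α) (L α) (g α) n else ∅
  have hB : ∀ {α}, Order.IsSuccLimit α → ∀ n, B α n = column (e α) (L α) (g α) n :=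
    fun h n => if_pos h
  refine ⟨B, ⟨fun α hα hlim n => ?_, fun α β h0 hαβ hβ m n => ?_, fun X hX D hDc => ?_⟩,
    fun α hα hlim n => ?_, fun α hα hlim m n hmn => ?_⟩
  · rw [hB hlim]
    exact column_cofinal (heL α hα hlim) _ n
  -- If both are limits, the intersection is finite and its maximum is the bound; otherwise one of
  -- the sets is empty.
  · by_cases hlim : Order.IsSuccLimit α ∧ Order.IsSuccLimit β
    · have hfin : (B α m ∩ B β n).Finite := by
        rw [hB hlim.1, hB hlim.2]
        refine (column_inter_Iio_finite (heL β hβ hlim.2) (g β) n hαβ).subset fun ξ hξ => ?_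
        exact ⟨hξ.2, column_subset (heL α (hαβ.trans hβ) hlim.1) _ m hξ.1⟩
      rcases (B α m ∩ B β n).eq_empty_or_nonempty with hemp | hne
      · exact ⟨0, h0, fun ξ hξ => by rw [hemp] at hξ; exact hξ.elim⟩
      · obtain ⟨δ, hδ, hmax⟩ := hfin.exists_maximal hne
        refine ⟨δ, ?_, fun ξ hξ => ?_⟩
        · have := hδ.1
          rw [hB hlim.1] at this
          exact column_subset (heL α (hαβ.trans hβ) hlim.1) _ m this
        · exact (le_total ξ δ).elim id fun h => hmax hξ h
    · refine ⟨0, h0, fun ξ hξ => ?_⟩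
      rcases not_and_or.1 hlim with h | h
      · exact ((if_neg h : B α m = ∅) ▸ hξ.1 : ξ ∈ (∅ : Set Ordinal.{0})).elim
      · exact ((if_neg h : B β n = ∅) ▸ hξ.2 : ξ ∈ (∅ : Set Ordinal.{0})).elim
  · obtain ⟨M, hMel, hMmono, hM, C, hC, hCd⟩ := hd' (guessSeq X) guessSeq_mem_H
      isContinuousSeq_guessSeq
    -- Uncountable cofinality makes the intersection of the two clubs a club.
    have hcof : Order.cof (Set.Iio (ω₁ : Ordinal.{0})) ≠ ℵ₀ := by
      rw [Ordinal.cof_Iio, ← Ordinal.lift_cof, Cardinal.cof_omega_one]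
      simp [Cardinal.aleph0_lt_aleph_one.ne']
    obtain ⟨α, ⟨hαC, hαD⟩, hlim, hαX⟩ := exists_limit_mem_club hX (hC.inter hcof hDc)
    refine ⟨α, fun γ hγ n => ?_, hαD⟩
    have hα : (α : Ordinal.{0}) < ω₁ := α.2
    have hE := heL α hα hlim
    have hup : ∀ {β : Ordinal.{0}}, β ≤ α → M (β + 1) ⊆ M (α + 1) := fun h =>
      hMmono _ _ (by gcongr) (hs hα)
    have hγs : γ + 1 < (α : Ordinal.{0}) := by
      rw [← Order.succ_eq_add_one]; exact hlim.succ_lt hγ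
    -- The clause `γ ≤ e α j` is needed because the entry of `guessSeq X` at `β + 1` records only `γ
    -- ≤ β`.
    have hchoose : ∀ k, ∃ j, e α j ∈ X γ ∧ L α k ≤ e α j ∧ γ ≤ e α j := by
      intro k
      obtain ⟨ξ, hξ, hle⟩ := (hαX γ hγ).2 _ (max_lt (hE.ladder_lt k) hγ)
      obtain ⟨j, rfl⟩ := hE.surj ξ hξ.2
      exact ⟨j, hξ.1, (le_max_left _ _).trans hle, (le_max_right _ _).trans hle⟩
    choose f hfX hfL hfγ using hchoose
    -- The parameters enter at stages `0`, `α` and `γ + 1` of `paramSeq`, and monotonicity carries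
    -- them into `M (α + 1)`.
    have hp : natColumns ∈ M (α + 1) := by
      have := (hM 0 hl.bot_lt).2.1
      rw [paramSeq_zero] at this
      exact hup bot_le this
    have hh : linkSet (e α) (L α) ∈ M (α + 1) := by
      have := (hM α hα).2.1
      rwa [paramSeq_limit e L hlim] at this
    have hc : Ordinal.toZFSet (γ + 1) ∈ M (α + 1) := by
      have := (hM (γ + 1) (hγs.trans hα)).2.1
      rw [paramSeq_add_one] at this
      exact hup hγs.le this
    -- The function `f` was chosen outside the model; elementarity replaces it by one inside, to
    -- which domination by `d α` applies.
    obtain ⟨F, hFM, hF⟩ := (hMel _ (hs hα)).exists_isLinkedSelector hp hh (hM α hα).1 hc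
      ⟨real f, real_mem_H f, isLinkedSelector_real hlim hE.lt hfX hfL hfγ⟩
    obtain ⟨f', rfl, hX', hL'⟩ := hF.exists_eq_real hlim
    obtain ⟨f₁, g₁, hf₁, hg₁, hdom⟩ := hCd α hαC _ ⟨f', rfl⟩ hFM
    rw [← hg α hα] at hg₁
    obtain rfl := real_injective hf₁
    obtain rfl := real_injective hg₁
    rw [hB hlim]
    exact column_inter_cofinal hE hdom hX' hL' n
  · refine type_eq_omega0 hlim ?_ ?_
    · rw [hB hlim]
      exact column_cofinal (heL α hα hlim) _ n
    · intro β hβ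
      rw [hB hlim]
      exact column_inter_Iio_finite (heL α hα hlim) _ n hβ
  · rw [hB hlim, hB hlim]
    exact column_disjoint (heL α hα hlim) _ hmn
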